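/- Let $E$ be a Hausdorff locally convex real topological vector space, let $K\subset E$ be a compact convex set, and let $B\subset K$ be a boundary of $K$, that is, for every continuous affine function $f:K\to\mathbb R$ there is a point $b\in B$ with $f(b)=\max_{x\in K} f(x)$. Then $w(K)\le nw_{cz}(B)$. Here $K$ and $B$ carry the subspace topologies. For a topological space $X$, $w(X)$ denotes the least cardinality of a base of $X$, plus $\omega$. A family $\mathcal N$ of subsets of $X$ is a $cz$-network of $X$ if every cozero set $U\subset X$ (a set of the form $U=\{x\in X: f(x)\neq 0\}$ with $f:X\to\mathbb R$ continuous) is the union of an at most countable subfamily of $\mathcal N$, and $nw_{cz}(X)$ denotes the least cardinality of a $cz$-network of $X$, plus $\omega$. -/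

import Mathlib

open scoped Cardinal

universe u

/-- The weight of a topological space: the least cardinality of a base, plus `ω`. -/
noncomputable def topWeight (X : Type u) [TopologicalSpace X] : Cardinal.{u} :=
  sInf {κ : Cardinal.{u} | ∃ 𝓑 : Set (Set X),
    TopologicalSpace.IsTopologicalBasis 𝓑 ∧ #𝓑 = κ} + ℵ₀

/-- A cozero set: the set where some continuous real-valued function does not vanish. -/
def IsCozeroSet {X : Type u} [TopologicalSpace X] (U : Set X) : Prop :=
  ∃ f : C(X, ℝ), U = {x | f x ≠ 0}

/-- A `cz`-network: a family of (arbitrary) subsets such that every cozero set is the union of an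
at most countable subfamily. -/
def IsCzNetwork {X : Type u} [TopologicalSpace X] (𝓕 : Set (Set X)) : Prop :=
  ∀ U : Set X, IsCozeroSet U → ∃ 𝓜 : Set (Set X), 𝓜 ⊆ 𝓕 ∧ 𝓜.Countable ∧ ⋃₀ 𝓜 = U

/-- The `cz`-network weight: the least cardinality of a `cz`-network, plus `ω`. -/
noncomputable def czNetworkWeight (X : Type u) [TopologicalSpace X] : Cardinal.{u} :=
  sInf {κ : Cardinal.{u} | ∃ 𝓕 : Set (Set X), IsCzNetwork 𝓕 ∧ #𝓕 = κ} + ℵ₀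

/-- `f` restricts to a continuous affine real-valued function on the set `K`. -/
def IsContAffineOn {E : Type u} [AddCommGroup E] [Module ℝ E] [TopologicalSpace E]
    (K : Set E) (f : E → ℝ) : Prop :=
  ContinuousOn f K ∧
    ∀ x ∈ K, ∀ y ∈ K, ∀ a b : ℝ, 0 ≤ a → 0 ≤ b → a + b = 1 →
      f (a • x + b • y) = a * f x + b * f y

/-- `B` is a boundary of `K`: `B ⊆ K`, and every continuous affine function on `K` attains its
maximum over `K` at some point of `B`. -/
def IsBoundaryOf {E : Type u} [AddCommGroup E] [Module ℝ E] [TopologicalSpace E]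
    (B K : Set E) : Prop :=
  B ⊆ K ∧ ∀ f : E → ℝ, IsContAffineOn K f → ∃ b ∈ B, IsMaxOn f K b

/-! Fix a minimal cz-network of `B`. For each finite list of constraints "a network set is mapped
into a rational interval", with an integer bound on `K`, choose one continuous affine function
obeying it, if any does. For a continuous affine `f`, countably many such constraints describe `f`
on `B`, so choices obeying longer and longer finite parts of them converge to `f` on `B`. A
Rainwater–Simons argument carries bounded pointwise convergence from the boundary to `K`. Hence the
chosen functions separate points, as continuous functionals do, and in a compact space a separating
family bounds the weight. -/

theorem IsContAffineOn.lincomb {E : Type u} [AddCommGroup E] [Module ℝ E] [TopologicalSpace E]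
    {K : Set E} {f g : E → ℝ} (hf : IsContAffineOn K f) (hg : IsContAffineOn K g) (c d : ℝ) :
    IsContAffineOn K (fun y => c * f y + d * g y) := by
  refine ⟨(hf.1.const_mul c).add (hg.1.const_mul d), fun x hx y hy a b ha hb hab => ?_⟩
  simp only [hf.2 x hx y hy a b ha hb hab, hg.2 x hx y hy a b ha hb hab]
  ring

theorem isContAffineOn_zero {E : Type u} [AddCommGroup E] [Module ℝ E] [TopologicalSpace E]
    (K : Set E) : IsContAffineOn K (fun _ => (0 : ℝ)) :=
  ⟨continuousOn_const, fun _ _ _ _ _ _ _ _ _ => by simp⟩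

theorem summable_half_pow_mul {u : ℕ → ℝ} {M : ℝ} (hu : ∀ n, |u n| ≤ M) :
    Summable fun n => (1 / 2 : ℝ) ^ (n + 1) * u n := by
  refine Summable.of_norm_bounded (g := fun n => (1 / 2 : ℝ) ^ (n + 1) * M)
    (((summable_nat_add_iff 1).2 summable_geometric_two).mul_right M) fun n => ?_
  rw [Real.norm_eq_abs, abs_mul, abs_of_nonneg (by positivity : (0 : ℝ) ≤ (1 / 2) ^ (n + 1))]
  exact mul_le_mul_of_nonneg_left (hu n) (by positivity)

theorem hasSum_half_pow_succ : HasSum (fun n : ℕ => (1 / 2 : ℝ) ^ (n + 1)) 1 := by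
  have h := hasSum_geometric_two.mul_left (1 / 2 : ℝ)
  simpa [pow_succ'] using h

theorem tsum_half_pow_mul_le {u : ℕ → ℝ} {M t : ℝ} (hu : ∀ n, |u n| ≤ M) (ht : ∀ n, u n ≤ t) :
    ∑' n, (1 / 2 : ℝ) ^ (n + 1) * u n ≤ t := by
  have h1 := hasSum_half_pow_succ.mul_right t
  rw [one_mul] at h1
  exact hasSum_le (fun n => mul_le_mul_of_nonneg_left (ht n) (by positivity))
    (summable_half_pow_mul hu).hasSum h1

theorem le_tsum_half_pow_mul {u : ℕ → ℝ} {M t : ℝ} (hu : ∀ n, |u n| ≤ M) (ht : ∀ n, t ≤ u n) :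
    t ≤ ∑' n, (1 / 2 : ℝ) ^ (n + 1) * u n := by
  have h1 := hasSum_half_pow_succ.mul_right t
  rw [one_mul] at h1
  exact hasSum_le (fun n => mul_le_mul_of_nonneg_left (ht n) (by positivity))
    h1 (summable_half_pow_mul hu).hasSum

theorem IsContAffineOn.tsum_half {E : Type u} [AddCommGroup E] [Module ℝ E] [TopologicalSpace E]
    {K : Set E} {g : ℕ → E → ℝ} {M : ℝ}
    (hg : ∀ n, IsContAffineOn K (g n)) (hM : ∀ n, ∀ y ∈ K, |g n y| ≤ M) :
    IsContAffineOn K (fun y => ∑' n, (1 / 2 : ℝ) ^ (n + 1) * g n y) := by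
  refine ⟨?_, fun x hx y hy a b ha hb hab => ?_⟩
  · refine continuousOn_tsum (u := fun n => (1 / 2 : ℝ) ^ (n + 1) * M)
      (fun n => (hg n).1.const_mul _)
      (((summable_nat_add_iff 1).2 summable_geometric_two).mul_right M) fun n y hy => ?_
    rw [Real.norm_eq_abs, abs_mul, abs_of_nonneg (by positivity : (0 : ℝ) ≤ (1 / 2) ^ (n + 1))]
    exact mul_le_mul_of_nonneg_left (hM n y hy) (by positivity)
  · have hx' := (summable_half_pow_mul fun n => hM n x hx).hasSum.mul_left a
    have hy' := (summable_half_pow_mul fun n => hM n y hy).hasSum.mul_left b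
    rw [← (hx'.add hy').tsum_eq]
    refine tsum_congr fun n => ?_
    rw [(hg n).2 x hx y hy a b ha hb hab]
    ring

/-! ### Simons' argument: from the boundary to `K` -/

/-- The continuous affine functions on `K` bounded by `M`, lying below the pointwise supremum of
the tail `f n, f (n + 1), …`, and at least `δ` at `x`. -/
def tailHull {E : Type u} [AddCommGroup E] [Module ℝ E] [TopologicalSpace E]
    (K : Set E) (f : ℕ → E → ℝ) (M δ : ℝ) (x : E) (n : ℕ) : Set (E → ℝ) :=
  {g | IsContAffineOn K g ∧ (∀ y ∈ K, |g y| ≤ M) ∧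
    (∀ y ∈ K, ∀ t, (∀ k, n ≤ k → f k y ≤ t) → g y ≤ t) ∧ δ ≤ g x}

theorem tailHull_anti {E : Type u} [AddCommGroup E] [Module ℝ E] [TopologicalSpace E]
    {K : Set E} {f : ℕ → E → ℝ} {M δ : ℝ} {x : E} : Antitone (tailHull K f M δ x) :=
  fun _ _ hmn _ hg => ⟨hg.1, hg.2.1,
    fun y hy t ht => hg.2.2.1 y hy t fun k hk => ht k (hmn.trans hk), hg.2.2.2⟩

theorem tsum_mem_tailHull {E : Type u} [AddCommGroup E] [Module ℝ E] [TopologicalSpace E]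
    {K : Set E} {f : ℕ → E → ℝ} {M δ : ℝ} {x : E} (hx : x ∈ K) {n : ℕ}
    {g : ℕ → E → ℝ} (hg : ∀ i, g i ∈ tailHull K f M δ x n) :
    (fun y => ∑' i, (1 / 2 : ℝ) ^ (i + 1) * g i y) ∈ tailHull K f M δ x n := by
  refine ⟨.tsum_half (fun i => (hg i).1) fun i => (hg i).2.1, fun y hy => ?_,
    fun y hy t ht => ?_, ?_⟩
  · rw [abs_le]
    exact ⟨le_tsum_half_pow_mul (fun i => (hg i).2.1 y hy)
        fun i => (abs_le.1 ((hg i).2.1 y hy)).1,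
      tsum_half_pow_mul_le (fun i => (hg i).2.1 y hy) fun i => (abs_le.1 ((hg i).2.1 y hy)).2⟩
  · exact tsum_half_pow_mul_le (fun i => (hg i).2.1 y hy) fun i => (hg i).2.2.1 y hy t ht
  · exact le_tsum_half_pow_mul (fun i => (hg i).2.1 x hx) fun i => (hg i).2.2.2

/-- The suprema over `K` of `h + c * g` are bounded below by the value at `x`, so their infimum over
`C` is finite and is attained up to `ε`. -/
theorem exists_almost_minimizer {E : Type u} [AddCommGroup E] [Module ℝ E] [TopologicalSpace E]
    {K : Set E} (hKc : IsCompact K) {x : E} (hx : x ∈ K) {C : Set (E → ℝ)} (hC : C.Nonempty)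
    (hCa : ∀ g ∈ C, IsContAffineOn K g) {δ : ℝ} (hδ : ∀ g ∈ C, δ ≤ g x) {c ε : ℝ} (hc : 0 ≤ c)
    (hε : 0 < ε) (h : E → ℝ) (hh : IsContAffineOn K h) :
    ∃ g ∈ C, ∀ g' ∈ C, ∀ s, (∀ z ∈ K, h z + c * g' z ≤ s) → ∀ y ∈ K, h y + c * g y ≤ s + ε := by
  let S : (E → ℝ) → ℝ := fun g => sSup ((fun y => h y + c * g y) '' K)
  have hbdd : ∀ g ∈ C, BddAbove ((fun y => h y + c * g y) '' K) := fun g hg =>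
    (hKc.image_of_continuousOn (hh.1.add ((hCa g hg).1.const_mul c))).bddAbove
  have hle : ∀ g ∈ C, ∀ y ∈ K, h y + c * g y ≤ S g := fun g hg y hy =>
    le_csSup (hbdd g hg) ⟨y, hy, rfl⟩
  have hb : BddBelow (S '' C) := by
    refine ⟨h x + c * δ, ?_⟩
    rintro _ ⟨g, hg, rfl⟩
    have := mul_le_mul_of_nonneg_left (hδ g hg) hc
    linarith [hle g hg x hx]
  obtain ⟨_, ⟨g, hg, rfl⟩, hlt⟩ := exists_lt_of_csInf_lt (hC.image S)
    (lt_add_of_pos_right (sInf (S '' C)) hε)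
  refine ⟨g, hg, fun g' hg' s hs y hy => ?_⟩
  have h1 : S g' ≤ s := csSup_le ⟨_, x, hx, rfl⟩ (by rintro _ ⟨z, hz, rfl⟩; exact hs z hz)
  have h2 : sInf (S '' C) ≤ S g' := csInf_le hb ⟨g', hg', rfl⟩
  linarith [hle g hg y hy]

/-- A one-sided Rainwater–Simons theorem: a bounded sequence of continuous affine functions that
tends to `0` on a boundary cannot stay away from `0` from above at a point of `K`. -/
theorem not_bounded_below_of_tendsto_zero_on_boundary {E : Type u} [AddCommGroup E] [Module ℝ E]
    [TopologicalSpace E] {K : Set E} (hKc : IsCompact K) {B : Set E}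
    (hB : IsBoundaryOf B K) {f : ℕ → E → ℝ} (hf : ∀ n, IsContAffineOn K (f n)) {M : ℝ}
    (hM : ∀ n, ∀ y ∈ K, |f n y| ≤ M)
    (hlim : ∀ b ∈ B, Filter.Tendsto (fun n => f n b) Filter.atTop (nhds 0))
    {x : E} (hx : x ∈ K) {δ : ℝ} (hδ : 0 < δ) : ¬ ∀ n, δ ≤ f n x := by
  intro hfx
  let C := tailHull K f M δ x
  have hfC : ∀ n, f n ∈ C n := fun n => ⟨hf n, hM n, fun y _ t ht => ht n le_rfl, hfx n⟩
  have hstep : ∀ (n : ℕ) (h : E → ℝ), ∃ g ∈ C n, IsContAffineOn K h → ∀ g' ∈ C n, ∀ s,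
      (∀ z ∈ K, h z + (1 / 2) ^ n * g' z ≤ s) →
      ∀ y ∈ K, h y + (1 / 2) ^ n * g y ≤ s + (1 / 4) ^ n * (δ / 4) := by
    intro n h
    by_cases hh : IsContAffineOn K h
    · obtain ⟨g, hg, hg'⟩ := exists_almost_minimizer hKc hx ⟨_, hfC n⟩ (fun g hg => hg.1)
        (fun g hg => hg.2.2.2) (by positivity : (0 : ℝ) ≤ (1 / 2) ^ n)
        (by positivity : 0 < (1 / 4) ^ n * (δ / 4)) h hh
      exact ⟨g, hg, fun _ => hg'⟩
    · exact ⟨_, hfC n, fun h => absurd h hh⟩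
  choose step hstepC hstep using hstep
  -- Partial sums of the series `c 0`. The choice of `g n` minimizes with weight `(1 / 2) ^ n`, the
  -- whole mass still to be spent, so that the tail `c n` is a competitor.
  let h : ℕ → E → ℝ := fun n =>
    Nat.rec (fun _ => 0) (fun n h y => 1 * h y + (1 / 2) ^ (n + 1) * step n h y) n
  let g : ℕ → E → ℝ := fun n => step n (h n)
  have hg : ∀ n, g n ∈ C n := fun n => hstepC n (h n)
  have h_succ : ∀ n y, h (n + 1) y = h n y + (1 / 2) ^ (n + 1) * g n y := fun n y => by
    change 1 * h n y + (1 / 2) ^ (n + 1) * g n y = _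
    rw [one_mul]
  have hh : ∀ n, IsContAffineOn K (h n) := by
    intro n
    induction n with
    | zero => exact isContAffineOn_zero K
    | succ n ih => exact ih.lincomb (hg n).1 1 _
  -- the normalized tails of the series
  let c : ℕ → E → ℝ := fun n y => ∑' i, (1 / 2 : ℝ) ^ (i + 1) * g (n + i) y
  have hc : ∀ n, c n ∈ C n := fun n =>
    tsum_mem_tailHull hx fun i => tailHull_anti (Nat.le_add_right n i) (hg (n + i))
  have hc_rec : ∀ n, ∀ y ∈ K, c n y = 1 / 2 * g n y + 1 / 2 * c (n + 1) y := by
    intro n y hy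
    have hs := summable_half_pow_mul fun i => (hg (n + i)).2.1 y hy
    change (∑' i, (1 / 2 : ℝ) ^ (i + 1) * g (n + i) y) = _
    rw [hs.tsum_eq_zero_add, ← tsum_mul_left]
    congr 1
    · simp
    · refine tsum_congr fun i => ?_
      rw [show n + (i + 1) = n + 1 + i by ring]
      ring
  have hdecomp : ∀ n, ∀ y ∈ K, c 0 y = h n y + (1 / 2) ^ n * c n y := by
    intro n y hy
    induction n with
    | zero => simp [h]
    | succ n ih => rw [ih, h_succ, hc_rec n y hy]; ring
  obtain ⟨b, hb, hmax⟩ := hB.2 (c 0) (hc 0).1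
  have hbK := hB.1 hb
  have hδb : δ ≤ c 0 b := (hc 0).2.2.2.trans (hmax hx)
  -- Near-minimality gives `g n b ≤ c n b + (1 / 2) ^ n * (δ / 4)`, and `c (n + 1) = 2 * c n - g n`,
  -- so each step loses at most `(1 / 2) ^ n * (δ / 4)`; the total loss stays below `δ / 2`.
  have hkey : ∀ n, δ / 2 + (1 / 2) ^ n * (δ / 2) ≤ c n b := by
    intro n
    induction n with
    | zero => simpa using hδb
    | succ n ih =>
      have h1 := hstep n (h n) (hh n) (c n) (hc n) (c 0 b)
        (fun z hz => by rw [← hdecomp n z hz]; exact hmax hz) b hbK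
      rw [hdecomp n b hbK] at h1
      have hp : (0 : ℝ) < (1 / 2) ^ n := by positivity
      have h4 : ((1 : ℝ) / 4) ^ n = (1 / 2) ^ n * (1 / 2) ^ n := by rw [← mul_pow]; norm_num
      rw [h4] at h1
      have h2 : g n b ≤ c n b + (1 / 2) ^ n * (δ / 4) := by
        refine le_of_mul_le_mul_left ?_ hp
        change h n b + (1 / 2) ^ n * g n b ≤ _ at h1
        linarith
      have h3 := hc_rec n b hbK
      rw [pow_succ]
      linarith
  obtain ⟨N, hN⟩ := Filter.eventually_atTop.1
    ((hlim b hb).eventually (ge_mem_nhds (by linarith : (0 : ℝ) < δ / 4)))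
  have h1 := (hc N).2.2.1 b hbK (δ / 4) hN
  have h2 : 0 < (1 / 2 : ℝ) ^ N * (δ / 2) := by positivity
  linarith [hkey N]

theorem tendsto_of_tendsto_on_boundary {E : Type u} [AddCommGroup E] [Module ℝ E]
    [TopologicalSpace E] {K : Set E} (hKc : IsCompact K) {B : Set E}
    (hB : IsBoundaryOf B K) {f : ℕ → E → ℝ} {g : E → ℝ} (hf : ∀ n, IsContAffineOn K (f n))
    (hg : IsContAffineOn K g) {M : ℝ} (hM : ∀ n, ∀ y ∈ K, |f n y| ≤ M)
    (hlim : ∀ b ∈ B, Filter.Tendsto (fun n => f n b) Filter.atTop (nhds (g b)))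
    {x : E} (hx : x ∈ K) : Filter.Tendsto (fun n => f n x) Filter.atTop (nhds (g x)) := by
  obtain ⟨M', hM'⟩ := hKc.exists_bound_of_continuousOn hg.1
  -- Failure for a sign `c` yields a subsequence of `c * (f n - g)` staying above `δ` at `x`,
  -- against the one-sided theorem.
  have key : ∀ c : ℝ, |c| = 1 → ∀ δ > 0, ∀ᶠ n in Filter.atTop, c * f n x + -c * g x < δ := by
    intro c hc δ hδ
    by_contra hcon
    obtain ⟨φ, hφ, hφ'⟩ := Filter.extraction_of_frequently_atTop (Filter.not_eventually.1 hcon)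
    refine not_bounded_below_of_tendsto_zero_on_boundary hKc hB (M := M + M')
      (f := fun n y => c * f (φ n) y + -c * g y)
      (fun n => (hf _).lincomb hg c (-c)) (fun n y hy => ?_) (fun b hb => ?_) hx hδ
      fun n => not_lt.1 (hφ' n)
    · refine (abs_add_le _ _).trans (add_le_add ?_ ?_)
      · rw [abs_mul, hc, one_mul]; exact hM _ y hy
      · rw [abs_mul, abs_neg, hc, one_mul]; exact hM' y hy
    · have := (((hlim b hb).comp hφ.tendsto_atTop).const_mul c).add_const (-c * g b)
      rwa [← add_mul, add_neg_cancel, zero_mul] at this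
  rw [Metric.tendsto_atTop']
  intro ε hε
  obtain ⟨N, hN⟩ := Filter.eventually_atTop.1
    ((key 1 (by simp) ε hε).and (key (-1) (by simp) ε hε))
  refine ⟨N, fun n hn => ?_⟩
  have := hN n hn.le
  rw [Real.dist_eq, abs_lt]
  constructor <;> linarith [this.1, this.2]

/-! ### Cardinal bounds and weight -/

theorem mk_prod_le_of_countable {α : Type u} {β : Type} [Countable β] {c : Cardinal.{u}}
    (hc : ℵ₀ ≤ c) (hα : #α ≤ c) : #(α × β) ≤ c := by
  rw [Cardinal.mk_prod, Cardinal.lift_uzero]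
  exact Cardinal.mul_le_of_le hc hα
    ((Cardinal.lift_le_aleph0.2 Cardinal.mk_le_aleph0).trans hc)

theorem mk_finset_le_of_le {α : Type u} {c : Cardinal.{u}} (hc : ℵ₀ ≤ c) (hα : #α ≤ c) :
    #(Finset α) ≤ c := by
  classical
  exact (Cardinal.mk_le_of_surjective List.toFinset_surjective).trans
    ((Cardinal.mk_list_le_max α).trans (max_le hc hα))

/-- A compact space whose points are separated by a family of continuous real functions has weight
at most the size of the family. -/
theorem topWeight_le_of_separating {X ι : Type u} [TopologicalSpace X] [CompactSpace X]
    (φ : ι → X → ℝ) (hφ : ∀ i, Continuous (φ i)) (hsep : ∀ x y, (∀ i, φ i x = φ i y) → x = y) :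
    topWeight X ≤ max #ι ℵ₀ := by
  have hemb : Topology.IsClosedEmbedding fun x i => φ i x :=
    (continuous_pi hφ).isClosedEmbedding fun x y h => hsep x y fun i => congrFun h i
  let s : Set (Set X) := Set.range fun t : ι × ℚ × ℚ => φ t.1 ⁻¹' Set.Ioo (t.2.1 : ℝ) t.2.2
  have hs : ‹TopologicalSpace X› = TopologicalSpace.generateFrom s := by
    refine le_antisymm (le_generateFrom ?_) ?_
    · rintro _ ⟨t, rfl⟩
      exact isOpen_Ioo.preimage (hφ t.1)
    · rw [hemb.isInducing.eq_induced, Pi.topologicalSpace, induced_iInf]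
      refine le_iInf fun i => ?_
      rw [induced_compose, Real.isTopologicalBasis_Ioo_rat.eq_generateFrom,
        induced_generateFrom_eq]
      refine le_generateFrom ?_
      rintro _ ⟨_, hI, rfl⟩
      simp only [Set.mem_iUnion, Set.mem_singleton_iff] at hI
      obtain ⟨p, q, -, rfl⟩ := hI
      exact TopologicalSpace.isOpen_generateFrom_of_mem ⟨(i, p, q), rfl⟩
  have hbasis := TopologicalSpace.isTopologicalBasis_of_subbasis hs
  have hsc : #s ≤ max #ι ℵ₀ := by
    exact Cardinal.mk_range_le.trans
      (mk_prod_le_of_countable (le_max_right _ _) (le_max_left _ _))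
  have hcard : #((fun f => ⋂₀ f) '' {f : Set (Set X) | f.Finite ∧ f ⊆ s}) ≤ max #ι ℵ₀ := by
    refine Cardinal.mk_image_le.trans ((Cardinal.mk_le_of_surjective
      (f := fun t : Finset s => ⟨Subtype.val '' (t : Set s), t.finite_toSet.image _,
        by rintro _ ⟨a, -, rfl⟩; exact a.2⟩) ?_).trans
      (mk_finset_le_of_le (le_max_right _ _) hsc))
    rintro ⟨f, hf, hfs⟩
    refine ⟨(hf.preimage Subtype.val_injective.injOn).toFinset, Subtype.ext ?_⟩
    simpa using hfs
  refine (add_le_add ((csInf_le' (show _ ∈ {κ : Cardinal.{u} | ∃ 𝓑 : Set (Set X),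
    TopologicalSpace.IsTopologicalBasis 𝓑 ∧ #𝓑 = κ} from ⟨_, hbasis, rfl⟩)).trans hcard) le_rfl).trans ?_
  exact (Cardinal.add_eq_left (le_max_right _ _) (le_max_right _ _)).le

/-! ### Approximation by functions obeying finitely many constraints -/

/-- `f` is bounded by `m` on `K` and maps each set of `σ` into the assigned rational interval. -/
def SatisfiesBounds {E : Type u} [AddCommGroup E] [Module ℝ E] [TopologicalSpace E]
    (K : Set E) {B : Set E} {𝓕 : Set (Set B)} (σ : Finset (𝓕 × ℚ × ℚ) × ℕ) (f : E → ℝ) : Prop :=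
  IsContAffineOn K f ∧ (∀ y ∈ K, |f y| ≤ σ.2) ∧
    ∀ t ∈ σ.1, ∀ b ∈ (t.1 : Set B), (t.2.1 : ℝ) < f b ∧ f b < t.2.2

theorem isCozeroSet_preimage_Ioo {X : Type u} [TopologicalSpace X] {f : X → ℝ} (hf : Continuous f)
    (p q : ℝ) : IsCozeroSet {x | p < f x ∧ f x < q} := by
  refine ⟨⟨fun x => max 0 (min (f x - p) (q - f x)), by fun_prop⟩, ?_⟩
  ext x
  simp only [Set.mem_ofPred_eq, ContinuousMap.coe_mk, ne_eq, max_eq_left_iff, not_le, lt_min_iff,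
    sub_pos]

theorem exists_tendsto_of_isCzNetwork {E : Type u} [AddCommGroup E] [Module ℝ E]
    [TopologicalSpace E] {K : Set E} (hKc : IsCompact K) {B : Set E} (hB : IsBoundaryOf B K)
    {𝓕 : Set (Set B)} (h𝓕 : IsCzNetwork 𝓕) {φ : Finset (𝓕 × ℚ × ℚ) × ℕ → E → ℝ}
    (hφ : ∀ σ f, SatisfiesBounds K σ f → SatisfiesBounds K σ (φ σ)) {f : E → ℝ}
    (hf : IsContAffineOn K f) : ∃ σ : ℕ → Finset (𝓕 × ℚ × ℚ) × ℕ, ∀ x ∈ K,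
      Filter.Tendsto (fun n => φ (σ n) x) Filter.atTop (nhds (f x)) := by
  obtain ⟨M, hM⟩ := hKc.exists_bound_of_continuousOn hf.1
  obtain ⟨m, hm⟩ := exists_nat_ge M
  have hfB : Continuous fun b : B => f b := continuousOn_iff_continuous_domRestrict.1 (hf.1.mono hB.1)
  choose 𝓜 h𝓜𝓕 h𝓜c h𝓜 using fun t : ℚ × ℚ =>
    h𝓕 _ (isCozeroSet_preimage_Ioo hfB (t.1 : ℝ) (t.2 : ℝ))
  -- All constraints needed for `f`: countably many, and `f` itself obeys each of them, so every
  -- finite part is satisfiable.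
  let P : Set (𝓕 × ℚ × ℚ) := {t | (t.1 : Set B) ∈ 𝓜 t.2}
  have hPc : P.Countable := by
    have : P = ⋃ t : ℚ × ℚ, (fun N : 𝓕 => (N, t)) '' (Subtype.val ⁻¹' 𝓜 t) := by
      ext ⟨N, t⟩
      simp [P]
    rw [this]
    exact Set.countable_iUnion fun t =>
      ((h𝓜c t).preimage Subtype.val_injective).image _
  have hcover : ∀ b : B, ∀ p q : ℚ, (p : ℝ) < f b → f b < q →
      ∃ t ∈ P, t.2 = (p, q) ∧ b ∈ (t.1 : Set B) := by
    intro b p q hp hq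
    have : b ∈ ⋃₀ 𝓜 (p, q) := by rw [h𝓜]; exact ⟨hp, hq⟩
    obtain ⟨N, hN, hbN⟩ := this
    exact ⟨(⟨N, h𝓜𝓕 _ hN⟩, p, q), hN, rfl, hbN⟩
  have hPne : P.Nonempty := by
    obtain ⟨b, hb, -⟩ := hB.2 f hf
    obtain ⟨p, hp⟩ := exists_rat_lt (f b)
    obtain ⟨q, hq⟩ := exists_rat_gt (f b)
    obtain ⟨t, ht, -⟩ := hcover ⟨b, hb⟩ p q hp hq
    exact ⟨t, ht⟩
  obtain ⟨e, he⟩ := hPc.exists_eq_range hPne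
  classical
  let σ : ℕ → Finset (𝓕 × ℚ × ℚ) × ℕ := fun n => ((Finset.range n).image e, m)
  have hσ : ∀ n, SatisfiesBounds K (σ n) (φ (σ n)) := by
    refine fun n => hφ _ f ⟨hf, fun y hy => (hM y hy).trans hm, fun t ht b hb => ?_⟩
    obtain ⟨i, -, rfl⟩ := Finset.mem_image.1 ht
    have hi : e i ∈ P := he ▸ Set.mem_range_self i
    have : b ∈ ⋃₀ 𝓜 (e i).2 := ⟨_, hi, hb⟩
    rw [h𝓜] at this
    exact this
  refine ⟨σ, fun x hx => tendsto_of_tendsto_on_boundary hKc hB (fun n => (hσ n).1) hf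
    (M := m) (fun n => (hσ n).2.1) (fun b hb => ?_) hx⟩
  refine tendsto_order.2 ⟨fun a ha => ?_, fun a ha => ?_⟩
  all_goals
    obtain ⟨r, hr, hr'⟩ := exists_rat_btwn ha
  · obtain ⟨q, hq⟩ := exists_rat_gt (f b)
    obtain ⟨t, ht, htpq, hbt⟩ := hcover ⟨b, hb⟩ r q hr' hq
    obtain ⟨i, rfl⟩ := he ▸ ht
    filter_upwards [Filter.eventually_gt_atTop i] with n hn
    have := (hσ n).2.2 (e i) (Finset.mem_image_of_mem e (Finset.mem_range.2 hn)) _ hbt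
    rw [htpq] at this
    exact hr.trans this.1
  · obtain ⟨p, hp⟩ := exists_rat_lt (f b)
    obtain ⟨t, ht, htpq, hbt⟩ := hcover ⟨b, hb⟩ p r hp hr
    obtain ⟨i, rfl⟩ := he ▸ ht
    filter_upwards [Filter.eventually_gt_atTop i] with n hn
    have := (hσ n).2.2 (e i) (Finset.mem_image_of_mem e (Finset.mem_range.2 hn)) _ hbt
    rw [htpq] at this
    exact this.2.trans hr'

theorem exists_isCzNetwork_card_add_aleph0 (X : Type u) [TopologicalSpace X] :
    ∃ 𝓕 : Set (Set X), IsCzNetwork 𝓕 ∧ #𝓕 + ℵ₀ = czNetworkWeight X := by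
  have hne : {κ : Cardinal.{u} | ∃ 𝓕 : Set (Set X), IsCzNetwork 𝓕 ∧ #𝓕 = κ}.Nonempty :=
    ⟨_, Set.univ, fun U _ => ⟨{U}, Set.subset_univ _, Set.countable_singleton U,
      Set.sUnion_singleton U⟩, rfl⟩
  obtain ⟨𝓕, h𝓕, hc⟩ := csInf_mem hne
  exact ⟨𝓕, h𝓕, by rw [hc, czNetworkWeight]⟩

theorem theoremt {E : Type u} [AddCommGroup E] [Module ℝ E] [TopologicalSpace E]
    [IsTopologicalAddGroup E] [ContinuousSMul ℝ E] [LocallyConvexSpace ℝ E] [T2Space E]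
    (K : Set E) (hKc : IsCompact K) (hKconv : Convex ℝ K)
    (B : Set E) (hB : IsBoundaryOf B K) :
    topWeight K ≤ czNetworkWeight B := by
  obtain ⟨𝓕, h𝓕, hcard⟩ := exists_isCzNetwork_card_add_aleph0 B
  have hex : ∀ σ : Finset (𝓕 × ℚ × ℚ) × ℕ, ∃ g : E → ℝ, IsContAffineOn K g ∧
      ∀ f, SatisfiesBounds K σ f → SatisfiesBounds K σ g := by
    intro σ
    by_cases h : ∃ f, SatisfiesBounds K σ f
    · obtain ⟨f, hf⟩ := h
      exact ⟨f, hf.1, fun _ _ => hf⟩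
    -- Unsatisfiable constraints get the zero function as a default.
    · exact ⟨_, isContAffineOn_zero K, fun f hf => absurd ⟨f, hf⟩ h⟩
  choose φ hφc hφ using hex
  have : CompactSpace K := isCompact_iff_compactSpace.1 hKc
  refine (topWeight_le_of_separating (fun σ (x : K) => φ σ x)
    (fun σ => continuousOn_iff_continuous_domRestrict.1 (hφc σ).1) fun x y hxy => ?_).trans ?_
  · by_contra hne
    obtain ⟨l, hl⟩ := geometric_hahn_banach_point_point (Subtype.coe_ne_coe.2 hne)
    have hlK : IsContAffineOn K l :=
      ⟨l.continuous.continuousOn, fun _ _ _ _ _ _ _ _ _ => by simp⟩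
    obtain ⟨σ, hσ⟩ := exists_tendsto_of_isCzNetwork hKc hB h𝓕 hφ hlK
    refine hl.ne (tendsto_nhds_unique (hσ x x.2) ?_)
    simpa only [hxy] using hσ y y.2
  · have hω : ℵ₀ ≤ #𝓕 + ℵ₀ := le_add_self
    rw [← hcard]
    exact max_le (mk_prod_le_of_countable hω (mk_finset_le_of_le hω
      (mk_prod_le_of_countable hω le_self_add))) hω
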